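/- Let $\Sigma$ be a hyperbolic (connected) graph, and let $\Delta$ be a graph obtained from $\Sigma$ by adding edges (so $\Delta$ has the same vertex set as $\Sigma$ and contains all edges of $\Sigma$; loops and multiple edges are allowed). Let $d_\Sigma$ and $d_\Delta$ be the combinatorial metrics. Suppose that there exists $M>0$ such that for all vertices $x,y$ joined by an edge in $\Delta$ and for every geodesic $p$ in $\Sigma$ between $x$ and $y$, every vertex $z$ of $p$ satisfies $d_\Delta(x,z)\le M$. If, moreover, $\Sigma$ is a quasi-tree, then $\Delta$ is also a quasi-tree. Here a quasi-tree is a connected graph $\Gamma$ that, with its combinatorial metric, is quasi-isometric to a tree $T$, i.e. there are $\lambda>1$, $C>0$ and a map $\phi\colon\Gamma\to T$ with $\frac1\lambda d_\Gamma(a,b)-C\le d_T(\phi(a),\phi(b))\le\lambda d_\Gamma(a,b)+C$ for all $a,b$ and such that $T$ is contained in the closed $C$-neighbourhood of $\phi(\Gamma)$. -/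

import Mathlib

/-! Graphs are Mathlib's multigraphs `Graph α β` (loops and parallel edges are allowed), with vertex
set `G.vertexSet`; they are metrised by the combinatorial metric on their vertices. -/

namespace QTree

universe u v

/-- An edge path of `G` from one vertex to another. -/
inductive Walk {α : Type u} {β : Type v} (G : Graph α β) : α → α → Type (max u v)
  | nil {x : α} (hx : x ∈ G.vertexSet) : Walk G x x
  | cons {x y z : α} (e : β) (h : G.IsLink e x y) (p : Walk G y z) : Walk G x z

/-- The number of edges of an edge path. -/
def Walk.length {α : Type u} {β : Type v} {G : Graph α β} : {x y : α} → Walk G x y → ℕ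
  | _, _, .nil _ => 0
  | _, _, .cons _ _ p => p.length + 1

/-- The list of the vertices through which an edge path goes, end points included. -/
def Walk.support {α : Type u} {β : Type v} {G : Graph α β} : {x y : α} → Walk G x y → List α
  | x, _, .nil _ => [x]
  | x, _, .cons _ _ p => x :: p.support

/-- A (nonempty) connected graph. -/
def Connected {α : Type u} {β : Type v} (G : Graph α β) : Prop :=
  G.vertexSet.Nonempty ∧ ∀ x ∈ G.vertexSet, ∀ y ∈ G.vertexSet, Nonempty (Walk G x y)

/-- The combinatorial metric: the least length of an edge path from `x` to `y`. It is used for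
vertices of connected graphs only (without any path the value is `0`). -/
noncomputable def dist {α : Type u} {β : Type v} (G : Graph α β) (x y : α) : ℕ :=
  sInf {n : ℕ | ∃ p : Walk G x y, p.length = n}

/-- A geodesic is an edge path whose length is the distance between its end points. -/
def Walk.IsGeodesic {α : Type u} {β : Type v} {G : Graph α β} {x y : α} (p : Walk G x y) : Prop :=
  p.length = dist G x y

/-- A hyperbolic graph: a connected graph in which, for some `δ ≥ 0`, every side of every geodesic
triangle lies in the closed `δ`-neighbourhood of the union of the other two sides. Since the vertices
of the triangle can be permuted (and edge paths reversed), it is enough to say this for one side. -/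
def IsHyperbolic {α : Type u} {β : Type v} (G : Graph α β) : Prop :=
  Connected G ∧ ∃ δ : ℝ, 0 ≤ δ ∧
    ∀ (x y z : α) (p : Walk G x y) (q : Walk G y z) (r : Walk G x z),
      p.IsGeodesic → q.IsGeodesic → r.IsGeodesic →
        ∀ a ∈ p.support, ∃ b, (b ∈ q.support ∨ b ∈ r.support) ∧ (dist G a b : ℝ) ≤ δ

/-- `φ` is a `(lam, C)`-quasi-isometry from `X`, with distance function `dX`, to `Y`, with distance
function `dY`. -/
structure IsQuasiIsometry {X Y : Type u} (dX : X → X → ℝ) (dY : Y → Y → ℝ) (lam C : ℝ)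
    (φ : X → Y) : Prop where
  lower : ∀ a b, 1 / lam * dX a b - C ≤ dY (φ a) (φ b)
  upper : ∀ a b, dY (φ a) (φ b) ≤ lam * dX a b + C
  coarselyOnto : ∀ y, ∃ a, dY y (φ a) ≤ C

/-- A quasi-tree: a connected graph that is quasi-isometric to a tree. -/
def IsQuasiTree {α : Type u} {β : Type v} (G : Graph α β) : Prop :=
  Connected G ∧
    ∃ (W : Type u) (T : SimpleGraph W), T.IsTree ∧
      ∃ (lam C : ℝ) (φ : G.vertexSet → W), 1 < lam ∧ 0 < C ∧
        IsQuasiIsometry (fun a b : G.vertexSet => (dist G a b : ℝ)) (fun s t => (T.dist s t : ℝ))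
          lam C φ

end QTree

/-!
The proof uses the layering tree of `D`. Fix a base vertex `o` and call two vertices equivalent if
they are at the same distance `n` from `o` and are joined by a path that stays at distance at least
`n` from `o`. Sending the class of a vertex `x ≠ o` to the class of a neighbour of `x` that is
closer to `o` is a well-defined parent function, so the classes are the vertices of a rooted tree,
and the projection to it does not increase distances. If all classes have diameter at most `K`, it
also does not decrease them by more than `K`
(`SimpleGraph.exists_isTree_of_layer_diam_le`).

It remains to bound the classes of `D`. Let `F` be a quasi-isometry from `S` to a tree `T`. An edge
of `D` joining `u` to `v` has a shadow in `T`: a walk from `F u` to `F v` obtained by joining the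
images of the consecutive vertices of an `S`-geodesic. By the hypothesis on geodesics, every vertex
of the shadow is near the image of a vertex that is `D`-close to `u`. Hence two paths of `D` whose
shadows come close to each other are themselves close to each other at the corresponding place, for
vertices with close images are close in `S` and so in `D`. Now let `x` and `y` be
equivalent, let `p` be the path witnessing this, and let `α`, `β` be geodesics from `o` to `x` and
`y`. The path of `T` from `F x` to `F y` lies in the shadow of `p` and is covered by the shadows of
`α` and `β`, so at some place of it all three meet. There `p`, `α` and `β` come close to each other;
as `p` avoids the ball around `o`, this happens near the ends of `α` and `β`, so `x` is close to `y`
(`SimpleGraph.layer_diam_le_of_shadow`).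
-/

/-! ### Trees given by a parent function -/

namespace SimpleGraph

universe u

/-- The graph in which every `w` is joined to `parent w` (unless the two are equal). -/
def parentGraph {W : Type*} (parent : W → W) : SimpleGraph W :=
  SimpleGraph.fromRel fun a b => parent a = b

lemma parentGraph_adj {W : Type*} {parent : W → W} {a b : W} :
    (parentGraph parent).Adj a b ↔ a ≠ b ∧ (parent a = b ∨ parent b = a) :=
  SimpleGraph.fromRel_adj _ _ _

lemma parentGraph_isTree {W : Type*} {parent : W → W} {r : W} (level : W → ℕ)
    (hr : parent r = r) (hlt : ∀ w, w ≠ r → level (parent w) < level w) :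
    (parentGraph parent).IsTree := by
  have hle : ∀ w, level (parent w) ≤ level w := by
    intro w
    by_cases h : w = r
    · rw [h, hr]
    · exact (hlt w h).le
  have hle' : ∀ k w, level (parent^[k] w) ≤ level w := by
    intro k
    induction k with
    | zero => intro w; rfl
    | succ k ih => intro w; exact (ih _).trans (hle w)
  have hbridge : ∀ w, w ≠ r → (parentGraph parent).IsBridge s(w, parent w) := by
    intro w hw
    rw [isBridge_iff]
    -- without the edge to its parent, only descendants of `w` can be reached from `w`
    have key : ∀ v v', ((parentGraph parent).deleteEdges {s(w, parent w)}).Walk v v' →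
        (∃ k, parent^[k] v = w) → ∃ k, parent^[k] v' = w := by
      intro v v' p
      induction p with
      | nil => exact id
      | cons h p ih =>
        rename_i a b c
        rintro ⟨k, hk⟩
        apply ih
        rw [deleteEdges_adj, parentGraph_adj] at h
        obtain ⟨⟨-, h1⟩, h2⟩ := h
        rcases h1 with h1 | h1
        · cases k with
          | zero =>
            simp only [Function.iterate_zero, id] at hk
            subst hk h1
            simp at h2
          | succ k => exact ⟨k, by rw [← h1]; exact hk⟩
        · exact ⟨k + 1, by rw [Function.iterate_succ_apply, h1]; exact hk⟩
    rintro ⟨p⟩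
    obtain ⟨k, hk⟩ := key _ _ p ⟨0, rfl⟩
    have h1 := hle' k (parent w)
    rw [hk] at h1
    exact absurd (hlt w hw) (not_lt.2 h1)
  have hreach : ∀ n w, level w = n → (parentGraph parent).Reachable r w := by
    intro n
    induction n using Nat.strong_induction_on with
    | _ n ih =>
      intro w hw
      by_cases h : w = r
      · rw [h]
      · have h1 := hlt w h
        refine (ih _ (hw ▸ h1) (parent w) rfl).trans (Adj.reachable ?_)
        refine parentGraph_adj.2 ⟨fun h2 => ?_, Or.inr rfl⟩
        rw [h2] at h1
        exact lt_irrefl _ h1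
  refine ⟨connected_iff_exists_forall_reachable _ |>.2 ⟨r, fun w => hreach _ w rfl⟩, ?_⟩
  rw [isAcyclic_iff_forall_adj_isBridge]
  intro v w h
  obtain ⟨hne, h | h⟩ := parentGraph_adj.1 h
  · subst h
    exact hbridge v fun hv => hne (by rw [hv, hr])
  · subst h
    rw [Sym2.eq_swap]
    exact hbridge w fun hv => hne (by rw [hv, hr])

lemma exists_iterate_eq_of_parentGraph_walk {W : Type*} {parent : W → W} {a b : W}
    (p : (parentGraph parent).Walk a b) :
    ∃ k l, k + l ≤ p.length ∧ parent^[k] a = parent^[l] b := by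
  induction p with
  | nil => exact ⟨0, 0, le_rfl, rfl⟩
  | cons h p ih =>
    rename_i a b c
    obtain ⟨k, l, hkl, hab⟩ := ih
    rw [Walk.length_cons]
    obtain ⟨-, h | h⟩ := parentGraph_adj.1 h
    · exact ⟨k + 1, l, by omega, by rw [Function.iterate_succ_apply, h, hab]⟩
    · cases k with
      | zero =>
        refine ⟨0, l + 1, by omega, ?_⟩
        rw [Function.iterate_succ_apply', ← hab, ← h]
        rfl
      | succ k => exact ⟨k, l, by omega, by rw [← hab, Function.iterate_succ_apply, h]⟩

/-! ### The layering tree of a connected graph -/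

/-- Two vertices are in the same layer class if they are at the same distance from `o` and are
joined by a walk that never comes closer to `o`. -/
def layerSetoid {V : Type*} (H : SimpleGraph V) (o : V) : Setoid V where
  r x y := H.dist o x = H.dist o y ∧ ∃ p : H.Walk x y, ∀ v ∈ p.support, H.dist o x ≤ H.dist o v
  iseqv :=
    { refl := fun x => ⟨rfl, .nil, by simp⟩
      symm := by
        rintro x y ⟨h, p, hp⟩
        exact ⟨h.symm, p.reverse, fun v hv => h ▸ hp v (by simpa using hv)⟩
      trans := by
        rintro x y z ⟨h, p, hp⟩ ⟨h', q, hq⟩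
        refine ⟨h.trans h', p.append q, fun v hv => ?_⟩
        rcases (Walk.mem_support_append_iff _ _).1 hv with hv | hv
        · exact hp v hv
        · exact h ▸ hq v hv }

lemma Connected.exists_adj_dist_succ {V : Type*} {H : SimpleGraph V} (hH : H.Connected) {o x : V}
    (hx : x ≠ o) : ∃ y, H.Adj x y ∧ H.dist o x = H.dist o y + 1 := by
  obtain ⟨p, hp⟩ := hH.exists_walk_length_eq_dist x o
  cases p with
  | nil => exact absurd rfl hx
  | cons h p =>
    rename_i y
    refine ⟨y, h, ?_⟩
    rw [Walk.length_cons] at hp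
    have h1 := H.dist_le p
    have h2 := hH.dist_triangle (u := x) (v := y) (w := o)
    rw [dist_eq_one_iff_adj.2 h] at h2
    rw [dist_comm (u := o), dist_comm (u := o)]
    omega

/-- If all layer classes have diameter at most `K`, then the projection to the layering tree
preserves distances up to `K`. -/
theorem exists_isTree_of_layer_diam_le {V : Type u} {H : SimpleGraph V} (hH : H.Connected) (o : V)
    (K : ℕ) (hK : ∀ x y (p : H.Walk x y), H.dist o x = H.dist o y →
      (∀ v ∈ p.support, H.dist o x ≤ H.dist o v) → H.dist x y ≤ K) :
    ∃ (W : Type u) (T : SimpleGraph W) (f : V → W), T.IsTree ∧ Function.Surjective f ∧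
      ∀ a b, T.dist (f a) (f b) ≤ H.dist a b ∧ H.dist a b ≤ T.dist (f a) (f b) + K := by
  classical
  have hex : ∀ x, ∃ y, (x = o → y = o) ∧ (x ≠ o → H.Adj x y ∧ H.dist o x = H.dist o y + 1) := by
    intro x
    by_cases hx : x = o
    · exact ⟨o, fun _ => rfl, fun h => absurd hx h⟩
    · obtain ⟨y, hy⟩ := hH.exists_adj_dist_succ hx
      exact ⟨y, fun h => absurd h hx, fun _ => hy⟩
  choose pred hpo hpred using hex
  let st := layerSetoid H o
  let W := Quotient st
  let f : V → W := Quotient.mk st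
  -- neighbours `x`, `y` with `y` one step further from `o` than `x`
  have hstep : ∀ x y, H.Adj x y → H.dist o y = H.dist o x + 1 → f (pred y) = f x := by
    intro x y hxy hd
    have hy : y ≠ o := by rintro rfl; simp at hd
    obtain ⟨h1, h2⟩ := hpred y hy
    refine Quotient.sound ⟨by omega, .cons h1.symm (.cons hxy.symm .nil), ?_⟩
    intro v hv
    simp only [Walk.support_cons, Walk.support_nil, List.mem_cons, List.not_mem_nil, or_false] at hv
    rcases hv with rfl | rfl | rfl <;> omega
  have hwd : ∀ x y, st.r x y → f (pred x) = f (pred y) := by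
    rintro x y ⟨hd, p, hp⟩
    by_cases hx : x = o
    · subst hx
      have : y = x := by
        rw [dist_self] at hd
        exact (hH.dist_eq_zero_iff.1 hd.symm).symm
      rw [this]
    · have hy : y ≠ o := by
        rintro rfl
        rw [dist_self] at hd
        exact hx (hH.dist_eq_zero_iff.1 hd).symm
      obtain ⟨h1, h2⟩ := hpred x hx
      obtain ⟨h3, h4⟩ := hpred y hy
      refine Quotient.sound ⟨by omega, (Walk.cons h1.symm p).append (.cons h3 .nil), ?_⟩
      intro v hv
      rw [Walk.mem_support_append_iff, Walk.support_cons, Walk.support_cons, Walk.support_nil,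
        List.mem_cons, List.mem_cons, List.mem_singleton] at hv
      rcases hv with (rfl | hv) | rfl | rfl
      · rfl
      · have := hp v hv
        omega
      · omega
      · omega
  let parent : W → W := Quotient.lift (fun x => f (pred x)) hwd
  let level : W → ℕ := Quotient.lift (fun x => H.dist o x) fun x y h => h.1
  have hparent : ∀ x, parent (f x) = f (pred x) := fun x => rfl
  have hlevel : ∀ x, level (f x) = H.dist o x := fun x => rfl
  have hiter : ∀ k x, parent^[k] (f x) = f (pred^[k] x) := by
    intro k
    induction k with
    | zero => intro x; rfl
    | succ k ih => intro x; exact ih (pred x)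
  have hdist : ∀ k x, H.dist x (pred^[k] x) ≤ k := by
    intro k
    induction k with
    | zero => intro x; simp
    | succ k ih =>
      intro x
      have h1 : H.dist x (pred x) ≤ 1 := by
        by_cases hx : x = o
        · rw [hpo x hx, hx]; simp
        · exact (dist_eq_one_iff_adj.2 (hpred x hx).1).le
      have h2 := ih (pred x)
      have h3 := hH.dist_triangle (u := x) (v := pred x) (w := pred^[k] (pred x))
      rw [Function.iterate_succ_apply]
      omega
  have hT : (parentGraph parent).IsTree := by
    refine parentGraph_isTree (r := f o) level ?_ ?_
    · rw [hparent, hpo o rfl]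
    · intro w
      refine Quotient.inductionOn w fun x => ?_
      change f x ≠ f o → level (f (pred x)) < level (f x)
      intro hx
      have := (hpred x fun h => hx (by rw [h])).2
      rw [hlevel, hlevel]
      omega
  have hadj : ∀ a b, H.Adj a b → (parentGraph parent).dist (f a) (f b) ≤ 1 := by
    intro a b hab
    by_cases hne : f a = f b
    · rw [hne]; simp
    · refine (dist_eq_one_iff_adj.2 (parentGraph_adj.2 ⟨hne, ?_⟩)).le
      have h1 := dist_eq_one_iff_adj.2 hab
      have h2 := hH.dist_triangle (u := o) (v := a) (w := b)
      have h3 := hH.dist_triangle (u := o) (v := b) (w := a)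
      rw [dist_comm (u := b)] at h3
      have h4 : H.dist o a = H.dist o b ∨ H.dist o b = H.dist o a + 1 ∨
        H.dist o a = H.dist o b + 1 := by omega
      rcases h4 with h4 | h4 | h4
      · have hst : st.r a b := by
          refine ⟨h4, .cons hab .nil, fun v hv => ?_⟩
          simp only [Walk.support_cons, Walk.support_nil, List.mem_cons, List.not_mem_nil,
            or_false] at hv
          rcases hv with rfl | rfl <;> omega
        exact absurd (Quotient.sound hst) hne
      · exact Or.inr (hstep a b hab h4)
      · exact Or.inl (hstep b a hab.symm h4)
  refine ⟨W, parentGraph parent, f, hT, Quotient.mk_surjective, fun a b => ⟨?_, ?_⟩⟩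
  · obtain ⟨p, hp⟩ := hH.exists_walk_length_eq_dist a b
    rw [← hp]
    clear hp
    induction p with
    | nil => simp
    | cons h p ih =>
      rename_i a b c
      have h1 := hadj a b h
      have h2 := hT.connected.dist_triangle (u := f a) (v := f b) (w := f c)
      rw [Walk.length_cons]
      omega
  · obtain ⟨p, hp⟩ := hT.connected.exists_walk_length_eq_dist (f a) (f b)
    obtain ⟨k, l, hkl, hab⟩ := exists_iterate_eq_of_parentGraph_walk p
    rw [hiter, hiter] at hab
    obtain ⟨h1, q, h2⟩ : st.r (pred^[k] a) (pred^[l] b) := Quotient.exact hab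
    have h3 := hK _ _ q h1 h2
    have h4 := hdist k a
    have h5 := hdist l b
    rw [dist_comm] at h5
    have h6 := hH.dist_triangle (u := a) (v := pred^[k] a) (w := b)
    have h7 := hH.dist_triangle (u := pred^[k] a) (v := pred^[l] b) (w := b)
    omega

/-! ### Shadows in a tree bound the layer classes -/

lemma Walk.exists_dist_le_one_of_cover {W : Type*} {T : SimpleGraph W} {A B : W → Prop} {a b : W}
    (p : T.Walk a b) (ha : A a) (hb : B b) (hp : ∀ v ∈ p.support, A v ∨ B v) :
    ∃ v ∈ p.support, ∃ w ∈ p.support, A v ∧ B w ∧ T.dist v w ≤ 1 := by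
  induction p with
  | nil => exact ⟨_, by simp, _, by simp, ha, hb, by simp⟩
  | cons h p ih =>
    rename_i a c b
    rcases hp c (by simp) with hc | hc
    · obtain ⟨v, hv, w, hw, h1⟩ := ih hc hb fun v hv => hp v (by simp [hv])
      exact ⟨v, by simp [hv], w, by simp [hw], h1⟩
    · exact ⟨a, by simp, c, by simp, ha, hc, (dist_eq_one_iff_adj.2 h).le⟩

/-- If every edge of `H` has a shadow in `T`, then so has every walk. -/
lemma Walk.exists_shadow {V W : Type*} {H : SimpleGraph V} {T : SimpleGraph W} {F : V → W}
    {M L : ℕ} (hF : ∀ u v, H.Adj u v → ∃ q : T.Walk (F u) (F v), ∀ s ∈ q.support,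
      ∃ z, H.dist u z ≤ M ∧ T.dist (F z) s ≤ L) {x y : V} (p : H.Walk x y) :
    ∃ q : T.Walk (F x) (F y), ∀ s ∈ q.support,
      ∃ u ∈ p.support, ∃ z, H.dist u z ≤ M ∧ T.dist (F z) s ≤ L := by
  induction p with
  | nil =>
    rename_i x
    refine ⟨.nil, fun s hs => ⟨x, by simp, x, by simp, ?_⟩⟩
    rw [Walk.support_nil, List.mem_singleton] at hs
    rw [hs, dist_self]
    exact Nat.zero_le _
  | cons h p ih =>
    obtain ⟨q, hq⟩ := hF _ _ h
    obtain ⟨q', hq'⟩ := ih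
    refine ⟨q.append q', fun s hs => ?_⟩
    rcases (Walk.mem_support_append_iff _ _).1 hs with hs | hs
    · exact ⟨_, by simp, hq s hs⟩
    · obtain ⟨u, hu, h1⟩ := hq' s hs
      exact ⟨u, by simp [hu], h1⟩

/-- The layer classes of `H` are uniformly bounded if the edges of `H` have shadows in a tree `T`
and vertices with close images in `T` are close. -/
theorem layer_diam_le_of_shadow {V W : Type*} {H : SimpleGraph V} (hH : H.Connected)
    {T : SimpleGraph W} (hT : T.IsTree) {F : V → W} {M L R : ℕ}
    (hF : ∀ u v, H.Adj u v → ∃ q : T.Walk (F u) (F v), ∀ s ∈ q.support,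
      ∃ z, H.dist u z ≤ M ∧ T.dist (F z) s ≤ L)
    (hR : ∀ a b, T.dist (F a) (F b) ≤ 2 * L + 1 → H.dist a b ≤ R)
    (o x y : V) (p : H.Walk x y) (hd : H.dist o x = H.dist o y)
    (hp : ∀ v ∈ p.support, H.dist o x ≤ H.dist o v) : H.dist x y ≤ 3 * (2 * M + R) := by
  classical
  have close : ∀ {u u' z z' : V} {s s' : W}, H.dist u z ≤ M → T.dist (F z) s ≤ L →
      H.dist u' z' ≤ M → T.dist (F z') s' ≤ L → T.dist s s' ≤ 1 →
      H.dist u u' ≤ 2 * M + R := by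
    intro u u' z z' s s' h1 h2 h3 h4 h5
    have h6 := hT.connected.dist_triangle (u := F z) (v := s) (w := F z')
    have h7 := hT.connected.dist_triangle (u := s) (v := s') (w := F z')
    rw [dist_comm] at h4
    have h8 := hR z z' (by omega)
    have h9 := hH.dist_triangle (u := u) (v := z) (w := u')
    have h10 := hH.dist_triangle (u := z) (v := z') (w := u')
    rw [dist_comm] at h3
    omega
  obtain ⟨α, hα⟩ := hH.exists_walk_length_eq_dist o x
  obtain ⟨β, hβ⟩ := hH.exists_walk_length_eq_dist o y
  obtain ⟨qp, hqp⟩ := p.exists_shadow hF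
  obtain ⟨qα, hqα⟩ := α.exists_shadow hF
  obtain ⟨qβ, hqβ⟩ := β.exists_shadow hF
  -- the path of `T` from `F x` to `F y` lies on every walk between these vertices
  have huniq : ∀ q : T.Walk (F x) (F y), ∀ v ∈ qp.bypass.support, v ∈ q.support := by
    intro q v hv
    have := hT.isAcyclic.subsingleton_path (F x) (F y)
    have h2 : qp.bypass = q.bypass := congrArg Subtype.val
      (Subsingleton.elim (α := T.Path (F x) (F y)) ⟨_, qp.bypass_isPath⟩ ⟨_, q.bypass_isPath⟩)
    rw [h2] at hv
    exact q.support_bypass_subset_support hv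
  obtain ⟨v, hv, w, hw, hvα, hwβ, hvw⟩ := qp.bypass.exists_dist_le_one_of_cover
    (A := fun v => v ∈ qα.support) (B := fun v => v ∈ qβ.support) (by simp) (by simp) (by
      intro v hv
      have := huniq (qα.reverse.append qβ) v hv
      simpa [Walk.mem_support_append_iff] using this)
  obtain ⟨u, hu, z, hz, hz'⟩ := hqp v (huniq qp v hv)
  obtain ⟨u₁, hu₁, z₁, hz₁, hz₁'⟩ := hqα v hvα
  obtain ⟨u₂, hu₂, z₂, hz₂, hz₂'⟩ := hqβ w hwβ
  have c₁ : H.dist u₁ u ≤ 2 * M + R := close hz₁ hz₁' hz hz' (by simp)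
  have c₂ : H.dist u u₂ ≤ 2 * M + R := close hz hz' hz₂ hz₂' hvw
  have c₁₂ : H.dist u₁ u₂ ≤ 2 * M + R := close hz₁ hz₁' hz₂ hz₂' hvw
  -- a vertex of a geodesic from `o` splits its length
  have split : ∀ {t s : V} (γ : H.Walk o t), γ.length = H.dist o t → s ∈ γ.support →
      H.dist o s + H.dist s t ≤ H.dist o t := by
    intro t s γ hγ hs
    have h1 := H.dist_le (γ.takeUntil s hs)
    have h2 := H.dist_le (γ.dropUntil s hs)
    have h3 := congrArg Walk.length (γ.take_spec hs)
    rw [Walk.length_append] at h3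
    omega
  have s₁ := split α hα hu₁
  have s₂ := split β hβ hu₂
  have hou := hp u hu
  have t₁ := hH.dist_triangle (u := o) (v := u₁) (w := u)
  have t₂ := hH.dist_triangle (u := o) (v := u₂) (w := u)
  have t₃ := hH.dist_triangle (u := x) (v := u₁) (w := y)
  have t₄ := hH.dist_triangle (u := u₁) (v := u₂) (w := y)
  rw [dist_comm (u := u₂) (v := u)] at t₂
  rw [dist_comm (u := x) (v := u₁)] at t₃
  omega

end SimpleGraph

/-! ### From multigraphs to simple graphs -/

namespace QTree

lemma dist_le_length {α : Type*} {β : Type*} {G : Graph α β} {x y : α} (p : Walk G x y) :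
    dist G x y ≤ p.length :=
  Nat.sInf_le ⟨p, rfl⟩

lemma Connected.exists_isGeodesic {α : Type*} {β : Type*} {G : Graph α β} (hG : Connected G)
    {x y : α} (hx : x ∈ G.vertexSet) (hy : y ∈ G.vertexSet) : ∃ p : Walk G x y, p.IsGeodesic := by
  obtain ⟨p⟩ := hG.2 x hx y hy
  exact Nat.sInf_mem (s := {n : ℕ | ∃ p : Walk G x y, p.length = n}) ⟨_, p, rfl⟩

lemma Walk.exists_length_eq_of_le {α : Type*} {β : Type*} {S D : Graph α β} (h : S ≤ D)
    {x y : α} (p : Walk S x y) : ∃ q : Walk D x y, q.length = p.length := by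
  induction p with
  | nil hx => exact ⟨.nil (h.vertexSet_mono hx), rfl⟩
  | cons e he p ih =>
    obtain ⟨q, hq⟩ := ih
    exact ⟨.cons e (h.isLink_mono he) q, congrArg (· + 1) hq⟩

lemma Connected.mono {α : Type*} {β : Type*} {S D : Graph α β} (hS : Connected S)
    (h : S.IsSpanningSubgraph D) : Connected D := by
  refine ⟨h.vertexSet_eq ▸ hS.1, fun x hx y hy => ?_⟩
  rw [← h.vertexSet_eq] at hx hy
  obtain ⟨p⟩ := hS.2 x hx y hy
  exact ⟨(p.exists_length_eq_of_le h.le).choose⟩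

lemma Connected.dist_anti {α : Type*} {β : Type*} {S D : Graph α β} (hS : Connected S)
    (h : S ≤ D) {x y : α} (hx : x ∈ S.vertexSet) (hy : y ∈ S.vertexSet) :
    dist D x y ≤ dist S x y := by
  obtain ⟨p, hp⟩ := hS.exists_isGeodesic hx hy
  obtain ⟨q, hq⟩ := p.exists_length_eq_of_le h
  rw [← hp, ← hq]
  exact dist_le_length q

/-- The simple graph on the vertices of a multigraph: loops are dropped and parallel edges
identified. -/
def toSimpleGraph {α : Type*} {β : Type*} (G : Graph α β) : SimpleGraph G.vertexSet :=
  SimpleGraph.fromRel fun a b => G.Adj a b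

lemma toSimpleGraph_adj {α : Type*} {β : Type*} {G : Graph α β} {a b : G.vertexSet} :
    (toSimpleGraph G).Adj a b ↔ a ≠ b ∧ G.Adj a b := by
  refine (SimpleGraph.fromRel_adj _ _ _).trans (and_congr_right fun _ => ?_)
  exact ⟨fun h => h.elim id Graph.Adj.symm, Or.inl⟩

lemma Walk.exists_toSimpleGraph_walk {α : Type*} {β : Type*} {G : Graph α β} {x y : α}
    (p : Walk G x y) (hx : x ∈ G.vertexSet) (hy : y ∈ G.vertexSet) :
    ∃ q : (toSimpleGraph G).Walk ⟨x, hx⟩ ⟨y, hy⟩, q.length ≤ p.length := by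
  induction p with
  | nil => exact ⟨.nil, le_rfl⟩
  | cons e he p ih =>
    rename_i x z y
    obtain ⟨q, hq⟩ := ih he.right_mem hy
    by_cases hxz : x = z
    · subst hxz
      exact ⟨q, hq.trans (Nat.le_succ _)⟩
    · have hadj : (toSimpleGraph G).Adj ⟨x, hx⟩ ⟨z, he.right_mem⟩ :=
        toSimpleGraph_adj.2 ⟨fun h => hxz (congrArg Subtype.val h), e, he⟩
      exact ⟨.cons hadj q, Nat.succ_le_succ hq⟩

lemma exists_walk_of_toSimpleGraph_walk {α : Type*} {β : Type*} {G : Graph α β}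
    {a b : G.vertexSet} (q : (toSimpleGraph G).Walk a b) :
    ∃ p : Walk G (a : α) (b : α), p.length = q.length := by
  induction q with
  | nil => exact ⟨.nil (Subtype.property _), rfl⟩
  | cons h q ih =>
    obtain ⟨p, hp⟩ := ih
    obtain ⟨-, e, he⟩ := toSimpleGraph_adj.1 h
    exact ⟨.cons e he p, congrArg (· + 1) hp⟩

lemma Connected.toSimpleGraph {α : Type*} {β : Type*} {G : Graph α β} (hG : Connected G) :
    (toSimpleGraph G).Connected := by
  have : Nonempty G.vertexSet := hG.1.to_subtype
  refine ⟨fun a b => ?_⟩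
  obtain ⟨p⟩ := hG.2 a a.2 b b.2
  exact ⟨(p.exists_toSimpleGraph_walk a.2 b.2).choose⟩

lemma Connected.toSimpleGraph_dist {α : Type*} {β : Type*} {G : Graph α β} (hG : Connected G)
    (a b : G.vertexSet) : (QTree.toSimpleGraph G).dist a b = dist G a b := by
  apply le_antisymm
  · obtain ⟨p, hp⟩ := hG.exists_isGeodesic a.2 b.2
    obtain ⟨q, hq⟩ := p.exists_toSimpleGraph_walk a.2 b.2
    rw [← hp]
    exact ((QTree.toSimpleGraph G).dist_le q).trans hq
  · obtain ⟨q, hq⟩ := hG.toSimpleGraph.exists_walk_length_eq_dist a b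
    obtain ⟨p, hp⟩ := exists_walk_of_toSimpleGraph_walk q
    rw [← hq, ← hp]
    exact dist_le_length p

/-- A walk whose edges are mapped to pairs at distance at most `L` in a connected graph `T` has a
shadow: a walk in `T` between the images of the ends, within `L` of the images of its vertices. -/
lemma Walk.exists_shadow {α β W : Type*} {S : Graph α β} {T : SimpleGraph W} (hT : T.Connected)
    {F : α → W} {L : ℕ} (hF : ∀ x y, S.Adj x y → T.dist (F x) (F y) ≤ L) {x y : α}
    (p : Walk S x y) :
    ∃ q : T.Walk (F x) (F y), ∀ s ∈ q.support,
      ∃ z ∈ p.support, z ∈ S.vertexSet ∧ T.dist (F z) s ≤ L := by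
  classical
  induction p with
  | nil hx =>
    refine ⟨.nil, fun s hs => ⟨_, by simp [Walk.support], hx, ?_⟩⟩
    rw [SimpleGraph.Walk.support_nil, List.mem_singleton] at hs
    rw [hs, SimpleGraph.dist_self]
    exact Nat.zero_le _
  | cons e he p ih =>
    rename_i x z y
    obtain ⟨q', hq'⟩ := ih
    obtain ⟨q, hq⟩ := hT.exists_walk_length_eq_dist (F x) (F z)
    refine ⟨q.append q', fun s hs => ?_⟩
    rcases (SimpleGraph.Walk.mem_support_append_iff _ _).1 hs with hs | hs
    · refine ⟨x, by simp [Walk.support], he.left_mem, ?_⟩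
      calc T.dist (F x) s ≤ (q.takeUntil s hs).length := T.dist_le _
        _ ≤ q.length := q.length_takeUntil_le_length hs
        _ ≤ L := hq ▸ hF x z ⟨e, he⟩
    · obtain ⟨t, ht, h⟩ := hq' s hs
      exact ⟨t, by simp [Walk.support, ht], h⟩

end QTree

/-! ### Adding edges to a quasi-tree -/

theorem theorem5 {α : Type*} {β : Type*} (S D : Graph α β)
    (hS : QTree.IsHyperbolic S)
    (hSD : S.IsSpanningSubgraph D)
    (M : ℝ) (hM : 0 < M)
    (hgeod : ∀ x y : α, D.Adj x y → ∀ p : QTree.Walk S x y, p.IsGeodesic →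
      ∀ z ∈ p.support, (QTree.dist D x z : ℝ) ≤ M)
    (hqt : QTree.IsQuasiTree S) :
    QTree.IsQuasiTree D := by
  classical
  obtain ⟨hSc, W, T, hT, lam, C, φ, hlam, hC, hφ⟩ := hqt
  have hDc := hSc.mono hSD
  have hV := hSD.vertexSet_eq
  obtain ⟨o, ho⟩ := hDc.1
  -- the map to the tree, with an irrelevant value outside the vertex set
  let F : α → W := fun x =>
    if h : x ∈ S.vertexSet then φ ⟨x, h⟩ else φ ⟨o, hV ▸ ho⟩
  have hFφ : ∀ x (hx : x ∈ S.vertexSet), F x = φ ⟨x, hx⟩ := fun x hx => dif_pos hx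
  let L := ⌈lam + C⌉₊
  let R := ⌈lam * ((2 * L + 1 : ℕ) + C)⌉₊
  have hL : ∀ x y, S.Adj x y → T.dist (F x) (F y) ≤ L := by
    rintro x y ⟨e, he⟩
    have h1 : QTree.dist S x y ≤ 1 :=
      QTree.dist_le_length (.cons e he (.nil he.right_mem))
    have h2 := hφ.upper ⟨x, he.left_mem⟩ ⟨y, he.right_mem⟩
    rw [← hFφ, ← hFφ] at h2
    have h3 : (QTree.dist S x y : ℝ) ≤ 1 := by exact_mod_cast h1
    have h4 : (T.dist (F x) (F y) : ℝ) ≤ lam + C := by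
      have := mul_le_mul_of_nonneg_left h3 (by linarith : (0 : ℝ) ≤ lam)
      simp only at h2
      linarith
    exact_mod_cast h4.trans (Nat.le_ceil _)
  have hR : ∀ a b : D.vertexSet, T.dist (F a) (F b) ≤ 2 * L + 1 →
      (QTree.toSimpleGraph D).dist a b ≤ R := by
    intro a b hab
    have ha : (a : α) ∈ S.vertexSet := hV.symm.subset a.2
    have hb : (b : α) ∈ S.vertexSet := hV.symm.subset b.2
    rw [hDc.toSimpleGraph_dist]
    refine (hSc.dist_anti hSD.le ha hb).trans ?_
    have h1 := hφ.lower ⟨a, ha⟩ ⟨b, hb⟩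
    rw [← hFφ, ← hFφ] at h1
    simp only at h1
    have h2 : (T.dist (F a) (F b) : ℝ) ≤ (2 * L + 1 : ℕ) := Nat.cast_le.2 hab
    have hpos : 0 < lam := by linarith
    have h3 : (QTree.dist S a b : ℝ) / lam ≤ (2 * L + 1 : ℕ) + C := by
      rw [one_div_mul_eq_div] at h1
      linarith
    rw [div_le_iff₀' hpos] at h3
    exact Nat.cast_le.1 (h3.trans (Nat.le_ceil _))
  have hshadow : ∀ u v : D.vertexSet, (QTree.toSimpleGraph D).Adj u v →
      ∃ q : T.Walk (F u) (F v), ∀ s ∈ q.support,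
        ∃ z : D.vertexSet, (QTree.toSimpleGraph D).dist u z ≤ ⌈M⌉₊ ∧ T.dist (F z) s ≤ L := by
    intro u v huv
    obtain ⟨p, hp⟩ := hSc.exists_isGeodesic (x := u) (y := v) (hV.symm.subset u.2)
      (hV.symm.subset v.2)
    obtain ⟨q, hq⟩ := p.exists_shadow hT.connected hL
    refine ⟨q, fun s hs => ?_⟩
    obtain ⟨z, hz, hzV, hzs⟩ := hq s hs
    refine ⟨⟨z, hV ▸ hzV⟩, ?_, hzs⟩
    rw [hDc.toSimpleGraph_dist]
    exact_mod_cast (hgeod u v (QTree.toSimpleGraph_adj.1 huv).2 p hp z hz).trans (Nat.le_ceil M)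
  obtain ⟨W', T', f, hT', hf, hdist⟩ := SimpleGraph.exists_isTree_of_layer_diam_le
    hDc.toSimpleGraph ⟨o, ho⟩ _ fun x y =>
      SimpleGraph.layer_diam_le_of_shadow (F := fun x => F x) hDc.toSimpleGraph hT hshadow hR _ x y
  generalize 3 * (2 * ⌈M⌉₊ + R) = K at hdist
  refine ⟨hDc, W', T', hT', 2, K + 1, f, one_lt_two, by positivity, ?_, ?_, ?_⟩
  · intro a b
    have h := (hdist a b).2
    rw [hDc.toSimpleGraph_dist] at h
    have h' : (QTree.dist D a b : ℝ) ≤ T'.dist (f a) (f b) + K := by exact_mod_cast h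
    have h0 : (0 : ℝ) ≤ QTree.dist D a b := Nat.cast_nonneg _
    linarith
  · intro a b
    have h := (hdist a b).1
    rw [hDc.toSimpleGraph_dist] at h
    have h' : (T'.dist (f a) (f b) : ℝ) ≤ QTree.dist D a b := by exact_mod_cast h
    have h0 : (0 : ℝ) ≤ QTree.dist D a b := Nat.cast_nonneg _
    have h1 : (0 : ℝ) ≤ K := Nat.cast_nonneg _
    linarith
  · intro w
    obtain ⟨a, rfl⟩ := hf w
    refine ⟨a, ?_⟩
    simp only [SimpleGraph.dist_self, Nat.cast_zero]
    positivity
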